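/- Let $c>0$, $\lambda>0$, $0<p<1$, and let $d_j=(\cos(\pi j/2),\sin(\pi j/2))$, with indices $j$ modulo $4$. A particle starts at the origin at time $0$ and moves in the plane at constant speed $c$; its initial direction $D(0)$ is uniformly distributed on $\{d_0,d_1,d_2,d_3\}$, and its direction $D(t)$ switches at the events of a homogeneous Poisson process of intensity $\lambda$. At each switch, independently of the Poisson process and of the past, a horizontal direction $d_j$ ($j=0,2$) turns to $d_{j+1}$ with probability $p$ and to $d_{j-1}$ with probability $1-p$, while a vertical direction $d_j$ ($j=1,3$) turns to $d_{j+1}$ with probability $1-p$ and to $d_{j-1}$ with probability $p$. Let $(X(t),Y(t))$ be the position at time $t$, that is $(X(t),Y(t))=c\int_0^t D(s)\,ds$. Let $I_0(x)=\sum_{k\ge 0}\frac{(x/2)^{2k}}{(k!)^2}$ be the modified Bessel function of the first kind of order zero. Then for every $t>0$ the distribution of $X(t)-Y(t)$ on the event $X(t)+Y(t)=ct$ has on the interval $|\eta|<ct$ the density $$g(\eta,t)=\frac{e^{-\lambda t}}{4c}\left[\lambda p\,I_0\!\left(\frac{\lambda p}{c}\sqrt{c^2t^2-\eta^2}\right)+\frac{\partial}{\partial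 t}I_0\!\left(\frac{\lambda p}{c}\sqrt{c^2t^2-\eta^2}\right)\right],\qquad |\eta|<ct,$$ that is, the derivative exists, $g(\cdot,t)$ is nonnegative and integrable on $(-ct,ct)$, and for every Borel set $B\subseteq(-ct,ct)$ $$\mathbb{P}\big(X(t)+Y(t)=ct,\ X(t)-Y(t)\in B\big)=\int_B g(\eta,t)\,d\eta .$$ -/

import Mathlib

open MeasureTheory ProbabilityTheory

noncomputable section

/-- The modified Bessel function of the first kind of order zero,
`I₀(x) = ∑ (x/2)^(2k) / (k!)²`. -/
def besselI0 (x : ℝ) : ℝ :=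
  ∑' k : ℕ, (x / 2) ^ (2 * k) / (k.factorial : ℝ) ^ 2

/-- First component of the direction `d_j = (cos (π j / 2), sin (π j / 2))`. -/
def dirX (j : Fin 4) : ℝ := Real.cos (Real.pi * (j : ℕ) / 2)

/-- Second component of the direction `d_j = (cos (π j / 2), sin (π j / 2))`. -/
def dirY (j : Fin 4) : ℝ := Real.sin (Real.pi * (j : ℕ) / 2)

/-- The probability that a switch takes the direction `d_i` to the direction `d_j` (indices are
mod 4). A horizontal direction (`i = 0, 2`) turns counterclockwise with probability `p` and
clockwise with probability `1 - p`; a vertical one (`i = 1, 3`) turns counterclockwise with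
probability `1 - p` and clockwise with probability `p`. -/
def turnProb (p : ℝ) (i j : Fin 4) : ℝ :=
  if j = i + 1 then (if i = 0 ∨ i = 2 then p else 1 - p)
  else if j = i - 1 then (if i = 0 ∨ i = 2 then 1 - p else p)
  else 0

variable {Ω : Type*}

/-- The time of the `n`-th switch, when the successive waiting times are `τ 0, τ 1, …`
(`switchTime τ 0 = 0` is the start of the motion). -/
def switchTime (τ : ℕ → Ω → ℝ) (n : ℕ) (ω : Ω) : ℝ :=
  ∑ k ∈ Finset.range n, τ k ω

/-- `N(t)`: the number of switches that occurred until time `t`. -/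
def switchCount (τ : ℕ → Ω → ℝ) (t : ℝ) (ω : Ω) : ℕ :=
  Set.ncard {n : ℕ | switchTime τ (n + 1) ω ≤ t}

/-- `D(t)`: the index of the direction at time `t`, where `ξ n` is the index of the direction
taken after `n` switches. -/
def direction (τ : ℕ → Ω → ℝ) (ξ : ℕ → Ω → Fin 4) (t : ℝ) (ω : Ω) : Fin 4 :=
  ξ (switchCount τ t ω) ω

/-- `X(t)`: the abscissa at time `t` of the particle that starts at the origin and moves with
speed `c` in the direction `D`. -/
def posX (c : ℝ) (τ : ℕ → Ω → ℝ) (ξ : ℕ → Ω → Fin 4) (t : ℝ) (ω : Ω) : ℝ :=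
  ∫ s in (0 : ℝ)..t, c * dirX (direction τ ξ s ω)

/-- `Y(t)`: the ordinate at time `t` of the same particle. -/
def posY (c : ℝ) (τ : ℕ → Ω → ℝ) (ξ : ℕ → Ω → Fin 4) (t : ℝ) (ω : Ω) : ℝ :=
  ∫ s in (0 : ℝ)..t, c * dirY (direction τ ξ s ω)

/-- The law of the random mechanism: the switches occur at the times of a homogeneous Poisson
process of intensity `lam` (the waiting times `τ n` are independent and exponential with
parameter `lam`); the successive directions `ξ 0, ξ 1, …` form a Markov chain whose initial law is
uniform on the four directions and whose transition probabilities are `turnProb p`; the waiting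
times and the chain of directions are independent. -/
structure IsPlanarMotion [MeasurableSpace Ω] (P : Measure Ω) (lam p : ℝ)
    (τ : ℕ → Ω → ℝ) (ξ : ℕ → Ω → Fin 4) : Prop where
  measurable_wait : ∀ n, Measurable (τ n)
  measurable_dir : ∀ n, Measurable (ξ n)
  wait_law : ∀ n, P.map (τ n) = expMeasure lam
  wait_indep : iIndepFun τ P
  dir_law : ∀ (n : ℕ) (a : ℕ → Fin 4),
    P.real {ω | ∀ k ≤ n, ξ k ω = a k} =
      1 / 4 * ∏ k ∈ Finset.range n, turnProb p (a k) (a (k + 1))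
  wait_dir_indep : IndepFun (fun ω n => τ n ω) (fun ω n => ξ n ω) P

/-- The function
`g(η,t) = e^{-λt}/(4c) [λp I₀((λp/c)√(c²t²-η²)) + ∂/∂t I₀((λp/c)√(c²t²-η²))]`. -/
def boundaryDensity (c lam p η t : ℝ) : ℝ :=
  Real.exp (-lam * t) / (4 * c) *
    (lam * p * besselI0 (lam * p / c * √(c ^ 2 * t ^ 2 - η ^ 2)) +
      deriv (fun s : ℝ => besselI0 (lam * p / c * √(c ^ 2 * s ^ 2 - η ^ 2))) t)

end

/-! Every direction has `dirX + dirY ≤ 1`, with equality only for d₀ and d₁. So X + Y = ct forces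
all directions used up to time t to be d₀ or d₁, and since almost surely no switch keeps the
direction, the path alternates between them. Each turn of such a path has probability p, so a given
start followed by n switches contributes pⁿ/4.

Let U be the time spent up to t in the direction other than the last. Then X - Y = ±c(t - 2U), the
sign being that of the last direction. U is a sum of complete waiting times, hence Erlang. The last
direction fills t - U with its own complete waits and the unfinished one, which has a Poisson
probability. By independence the product of the two is the density of U
(`measure_sum_mem_and_sum_le_lt`, `IsPlanarMotion.measure_alternatingEvent`). Paths without a switch
only reach η = ±ct, outside the interval.

It remains to sum over the number of switches and the two starts. Put x = (t - η/c)/2 and y = (t +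
η/c)/2, so that xy = (c²t² - η²)/(4c²) and x + y = t. Odd numbers of switches produce (xy)ᵏ/(k!)²,
the I₀ term. Positive even numbers produce xᵏyᵏ⁺¹ + xᵏ⁺¹yᵏ = t(xy)ᵏ over k!(k+1)!, the time
derivative (`hasSum_occupationDensity`). -/

/-! ### Power series of I₀ and its derivative. -/

/-- The power series `∑ zᵏ / (k!)²`, in terms of which `I₀(x) = besselSeries ((x / 2) ^ 2)`. -/
noncomputable def besselSeries (z : ℝ) : ℝ := ∑' k : ℕ, z ^ k / (k.factorial : ℝ) ^ 2

/-- The power series `∑ zᵏ / (k! (k + 1)!)`, the derivative of `besselSeries`. -/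
noncomputable def besselSeriesDeriv (z : ℝ) : ℝ :=
  ∑' k : ℕ, z ^ k / ((k.factorial : ℝ) * ((k + 1).factorial : ℝ))

theorem besselI0_eq_besselSeries (x : ℝ) : besselI0 x = besselSeries ((x / 2) ^ 2) := by
  simp only [besselI0, besselSeries, pow_mul]

theorem summable_besselSeries (z : ℝ) :
    Summable fun k : ℕ => z ^ k / (k.factorial : ℝ) ^ 2 := by
  refine Summable.of_norm_bounded (Real.summable_pow_div_factorial |z|) fun k => ?_
  have h1 : (1 : ℝ) ≤ k.factorial := by exact_mod_cast k.factorial_pos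
  rw [norm_div, norm_pow, norm_pow, Real.norm_eq_abs, Real.norm_natCast]
  gcongr
  nlinarith

theorem summable_besselSeriesDeriv (z : ℝ) :
    Summable fun k : ℕ => z ^ k / ((k.factorial : ℝ) * ((k + 1).factorial : ℝ)) := by
  refine Summable.of_norm_bounded (Real.summable_pow_div_factorial |z|) fun k => ?_
  have h1 : (1 : ℝ) ≤ k.factorial := by exact_mod_cast k.factorial_pos
  have h2 : (1 : ℝ) ≤ (k + 1).factorial := by exact_mod_cast (k + 1).factorial_pos
  rw [norm_div, norm_pow, norm_mul, Real.norm_eq_abs, Real.norm_natCast, Real.norm_natCast]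
  gcongr
  nlinarith

/-- Termwise differentiation on the ball of radius |z| + 1, where the derived terms are dominated by
their values at |z| + 1. -/
theorem hasDerivAt_besselSeries (z : ℝ) :
    HasDerivAt besselSeries (besselSeriesDeriv z) z := by
  have hb : Summable fun k : ℕ =>
      (k : ℝ) * (|z| + 1) ^ (k - 1) / (k.factorial : ℝ) ^ 2 := by
    -- The term k = 0 vanishes; after the shift, k zᵏ⁻¹/(k!)² becomes zᵏ/(k!(k+1)!).
    rw [← summable_nat_add_iff 1]
    refine (summable_besselSeriesDeriv (|z| + 1)).congr fun k => ?_
    have h1 : (k.factorial : ℝ) ≠ 0 := by exact_mod_cast k.factorial_ne_zero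
    rw [Nat.factorial_succ]
    push_cast
    field_simp
  have key := hasDerivAt_tsum_of_isPreconnected (g := fun (k : ℕ) (y : ℝ) =>
      y ^ k / (k.factorial : ℝ) ^ 2) (g' := fun (k : ℕ) (y : ℝ) =>
      (k : ℝ) * y ^ (k - 1) / (k.factorial : ℝ) ^ 2) (t := Metric.ball 0 (|z| + 1))
    (y₀ := z) (y := z) hb Metric.isOpen_ball
    (convex_ball (0 : ℝ) _).isPreconnected
    (fun k y _ => (hasDerivAt_pow k y).div_const _)
    (fun k y hy => by
      rw [mem_ball_zero_iff, Real.norm_eq_abs] at hy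
      rw [norm_div, norm_mul, norm_pow, norm_pow, Real.norm_natCast, Real.norm_natCast,
        Real.norm_eq_abs]
      gcongr)
    (by simp) (summable_besselSeries z) (by simp)
  have hs : (∑' k : ℕ, (k : ℝ) * z ^ (k - 1) / (k.factorial : ℝ) ^ 2) = besselSeriesDeriv z := by
    have h0 : Summable fun k : ℕ => (k : ℝ) * z ^ (k - 1) / (k.factorial : ℝ) ^ 2 := by
      refine Summable.of_norm_bounded hb fun k => ?_
      rw [norm_div, norm_mul, norm_pow, norm_pow, Real.norm_natCast, Real.norm_natCast,
        Real.norm_eq_abs]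
      gcongr
      linarith
    rw [h0.tsum_eq_zero_add, besselSeriesDeriv]
    simp only [Nat.cast_zero, zero_mul, zero_div, zero_add]
    refine tsum_congr fun k => ?_
    have h1 : (k.factorial : ℝ) ≠ 0 := by exact_mod_cast k.factorial_ne_zero
    rw [Nat.factorial_succ]
    push_cast
    field_simp
  rw [← hs]
  exact key

/-- The time derivative of `I₀(κ √(c²s² - η²))` in the interior of the light cone. -/
theorem hasDerivAt_besselI0_sqrt {c η t κ : ℝ} (h : 0 < c ^ 2 * t ^ 2 - η ^ 2) :
    HasDerivAt (fun s : ℝ => besselI0 (κ * √(c ^ 2 * s ^ 2 - η ^ 2)))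
      (besselSeriesDeriv (κ ^ 2 * (c ^ 2 * t ^ 2 - η ^ 2) / 4) * (κ ^ 2 * c ^ 2 * t / 2)) t := by
  have h1 : HasDerivAt (fun s : ℝ => κ ^ 2 * (c ^ 2 * s ^ 2 - η ^ 2) / 4)
      (κ ^ 2 * c ^ 2 * t / 2) t := by
    have := ((((hasDerivAt_pow 2 t).const_mul (c ^ 2)).sub_const (η ^ 2)).const_mul
      (κ ^ 2)).div_const 4
    refine this.congr_deriv ?_
    push_cast
    ring
  have h2 := (hasDerivAt_besselSeries (κ ^ 2 * (c ^ 2 * t ^ 2 - η ^ 2) / 4)).comp t h1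
  refine h2.congr_of_eventuallyEq ?_
  have hc : ContinuousAt (fun s : ℝ => c ^ 2 * s ^ 2 - η ^ 2) t := by fun_prop
  filter_upwards [hc.eventually (lt_mem_nhds h)] with s hs
  rw [besselI0_eq_besselSeries, Function.comp, div_pow, mul_pow, Real.sq_sqrt hs.le]
  norm_num

theorem boundaryDensity_eq {c lam p η t : ℝ} (hc : 0 < c) (h : 0 < c ^ 2 * t ^ 2 - η ^ 2) :
    boundaryDensity c lam p η t = Real.exp (-lam * t) / (4 * c) *
      (lam * p * besselSeries ((lam * p) ^ 2 * ((c ^ 2 * t ^ 2 - η ^ 2) / (4 * c ^ 2))) +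
        (lam * p) ^ 2 * t / 2 *
          besselSeriesDeriv ((lam * p) ^ 2 * ((c ^ 2 * t ^ 2 - η ^ 2) / (4 * c ^ 2)))) := by
  rw [boundaryDensity, (hasDerivAt_besselI0_sqrt h).deriv, besselI0_eq_besselSeries, div_pow,
    mul_pow, Real.sq_sqrt h.le]
  have e1 : (lam * p / c) ^ 2 * (c ^ 2 * t ^ 2 - η ^ 2) / 2 ^ 2 =
      (lam * p) ^ 2 * ((c ^ 2 * t ^ 2 - η ^ 2) / (4 * c ^ 2)) := by
    field_simp; norm_num
  have e2 : (lam * p / c) ^ 2 * (c ^ 2 * t ^ 2 - η ^ 2) / 4 =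
      (lam * p) ^ 2 * ((c ^ 2 * t ^ 2 - η ^ 2) / (4 * c ^ 2)) := by
    field_simp
  rw [e1, e2]
  field_simp

/-! ### Erlang laws and Poisson probabilities. -/

/-- The density of the sum of `k + 1` independent exponential variables of parameter `lam`. -/
noncomputable def erlangPDF (lam : ℝ) (k : ℕ) (x : ℝ) : ENNReal :=
  ENNReal.ofReal (if 0 ≤ x then
    lam ^ (k + 1) * Real.exp (-(lam * x)) * (x ^ k / (k.factorial : ℝ)) else 0)

/-- The law of the sum of `m` independent exponential variables of parameter `lam`. -/
noncomputable def erlangMeasure (lam : ℝ) : ℕ → Measure ℝ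
  | 0 => Measure.dirac 0
  | k + 1 => volume.withDensity (erlangPDF lam k)

theorem measurable_erlangPDF (lam : ℝ) (k : ℕ) : Measurable (erlangPDF lam k) := by
  unfold erlangPDF
  refine ENNReal.measurable_ofReal.comp (Measurable.ite measurableSet_Ici ?_ measurable_const)
  fun_prop

theorem expMeasure_eq_withDensity (lam : ℝ) :
    expMeasure lam = volume.withDensity (exponentialPDF lam) := rfl

theorem erlangPDF_zero (lam : ℝ) : erlangPDF lam 0 = exponentialPDF lam := by
  ext x
  simp [erlangPDF, exponentialPDF_eq]

theorem setLIntegral_Icc_mul_pow_div_factorial {C x : ℝ} (hC : 0 ≤ C) (hx : 0 ≤ x) (k : ℕ) :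
    ∫⁻ y in Set.Icc 0 x, ENNReal.ofReal (C * (y ^ k / (k.factorial : ℝ))) =
      ENNReal.ofReal (C * (x ^ (k + 1) / ((k + 1).factorial : ℝ))) := by
  have hcont : Continuous fun y : ℝ => C * (y ^ k / (k.factorial : ℝ)) := by fun_prop
  rw [← ofReal_integral_eq_lintegral_ofReal (hcont.integrableOn_Icc)]
  · congr 1
    rw [integral_Icc_eq_integral_Ioc, ← intervalIntegral.integral_of_le hx,
      intervalIntegral.integral_const_mul, intervalIntegral.integral_div, integral_pow,
      Nat.factorial_succ]
    have h1 : (k.factorial : ℝ) ≠ 0 := by exact_mod_cast k.factorial_ne_zero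
    push_cast
    field_simp
    simp
  · filter_upwards [ae_restrict_mem measurableSet_Icc] with y hy
    have := hy.1
    positivity

/-- The product of the exponentials at y and x - y does not depend on y, so only a monomial is left
to integrate over [0, x]. -/
theorem erlangPDF_lconvolution_exponentialPDF {lam : ℝ} (hlam : 0 < lam) (k : ℕ) :
    lconvolution (erlangPDF lam k) (exponentialPDF lam) volume = erlangPDF lam (k + 1) := by
  ext x
  rw [lconvolution_def]
  have hint : ∀ y, erlangPDF lam k y * exponentialPDF lam (-y + x) =
      (Set.Icc 0 x).indicator (fun y => ENNReal.ofReal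
        (lam ^ (k + 2) * Real.exp (-(lam * x)) * (y ^ k / (k.factorial : ℝ)))) y := by
    intro y
    by_cases h0 : 0 ≤ y
    · by_cases h1 : y ≤ x
      · rw [Set.indicator_of_mem (Set.mem_Icc.2 ⟨h0, h1⟩), erlangPDF, exponentialPDF_eq, if_pos h0,
          if_pos (by linarith), ← ENNReal.ofReal_mul (by positivity)]
        congr 1
        rw [show -(lam * x) = -(lam * y) + -(lam * (-y + x)) by ring, Real.exp_add]
        ring
      · rw [Set.indicator_of_notMem (fun h => h1 h.2), exponentialPDF_eq,
          if_neg (by linarith)]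
        simp
    · rw [Set.indicator_of_notMem (fun h => h0 h.1), erlangPDF, if_neg h0]
      simp
  simp_rw [hint]
  rw [lintegral_indicator measurableSet_Icc]
  by_cases hx : 0 ≤ x
  · rw [setLIntegral_Icc_mul_pow_div_factorial (by positivity) hx, erlangPDF, if_pos hx]
  · rw [Set.Icc_eq_empty hx, erlangPDF, if_neg hx]
    simp

theorem erlangMeasure_conv_expMeasure {lam : ℝ} (hlam : 0 < lam) (m : ℕ) :
    (erlangMeasure lam m).conv (expMeasure lam) = erlangMeasure lam (m + 1) := by
  have := isProbabilityMeasure_expMeasure hlam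
  cases m with
  | zero =>
    simp only [erlangMeasure]
    rw [Measure.dirac_zero_conv, erlangPDF_zero, expMeasure_eq_withDensity]
  | succ k =>
    have hS : SigmaFinite (volume.withDensity (exponentialPDF lam)) := by
      rw [← expMeasure_eq_withDensity]; infer_instance
    simp only [erlangMeasure]
    rw [expMeasure_eq_withDensity, conv_withDensity_eq_lconvolution
      (measurable_erlangPDF _ _) (by rw [← erlangPDF_zero]; exact measurable_erlangPDF _ _),
      erlangPDF_lconvolution_exponentialPDF hlam]

theorem isProbabilityMeasure_erlangMeasure {lam : ℝ} (hlam : 0 < lam) (m : ℕ) :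
    IsProbabilityMeasure (erlangMeasure lam m) := by
  have := isProbabilityMeasure_expMeasure hlam
  induction m with
  | zero => rw [erlangMeasure]; infer_instance
  | succ k ih => rw [← erlangMeasure_conv_expMeasure hlam]; infer_instance

theorem expMeasure_Ioi {lam a : ℝ} (hlam : 0 < lam) (ha : 0 ≤ a) :
    expMeasure lam (Set.Ioi a) = ENNReal.ofReal (Real.exp (-(lam * a))) := by
  have := isProbabilityMeasure_expMeasure hlam
  rw [← Set.compl_Iic, prob_compl_eq_one_sub measurableSet_Iic, expMeasure_eq_withDensity,
    withDensity_apply _ measurableSet_Iic, lintegral_exponentialPDF_eq_antiDeriv hlam,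
    if_pos ha, ← ENNReal.ofReal_one, ← ENNReal.ofReal_sub]
  · congr 1; ring
  · have : Real.exp (-(lam * a)) ≤ 1 := Real.exp_le_one_iff.2 (by nlinarith)
    linarith

theorem measurableSet_le_lt_add (w : ℝ) :
    MeasurableSet {q : ℝ × ℝ | q.1 ≤ w ∧ w < q.1 + q.2} :=
  (measurableSet_le measurable_fst measurable_const).inter
    (measurableSet_lt measurable_const (measurable_fst.add measurable_snd))

/-- The number of renewals up to time `w` has the Poisson law of parameter `lam * w`. -/
theorem erlangMeasure_prod_expMeasure_le_lt {lam : ℝ} (hlam : 0 < lam) (m : ℕ) (w : ℝ) :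
    ((erlangMeasure lam m).prod (expMeasure lam)) {q | q.1 ≤ w ∧ w < q.1 + q.2} =
      ENNReal.ofReal (if 0 ≤ w then
        lam ^ m * Real.exp (-(lam * w)) * (w ^ m / (m.factorial : ℝ)) else 0) := by
  have := isProbabilityMeasure_expMeasure hlam
  rw [Measure.prod_apply (measurableSet_le_lt_add w)]
  have hsec : ∀ x : ℝ, expMeasure lam (Prod.mk x ⁻¹' {q : ℝ × ℝ | q.1 ≤ w ∧ w < q.1 + q.2}) =
      if x ≤ w then ENNReal.ofReal (Real.exp (-(lam * (w - x)))) else 0 := by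
    intro x
    split_ifs with hx
    · rw [← expMeasure_Ioi hlam (sub_nonneg.2 hx)]
      congr 1
      ext y
      simp only [Set.mem_preimage, Set.mem_ofPred_eq, Set.mem_Ioi]
      constructor
      · intro h; linarith [h.2]
      · intro h; exact ⟨hx, by linarith⟩
    · simp [hx]
  simp_rw [hsec]
  cases m with
  | zero =>
    rw [erlangMeasure, lintegral_dirac]
    split_ifs <;> simp
  | succ k =>
    have hm : Measurable fun x : ℝ =>
        if x ≤ w then ENNReal.ofReal (Real.exp (-(lam * (w - x)))) else 0 :=
      Measurable.ite measurableSet_Iic (by fun_prop) measurable_const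
    rw [erlangMeasure, lintegral_withDensity_eq_lintegral_mul _ (measurable_erlangPDF _ _) hm]
    have hint : ∀ x, (erlangPDF lam k * fun x : ℝ =>
        if x ≤ w then ENNReal.ofReal (Real.exp (-(lam * (w - x)))) else 0) x =
        (Set.Icc 0 w).indicator (fun y => ENNReal.ofReal
        (lam ^ (k + 1) * Real.exp (-(lam * w)) * (y ^ k / (k.factorial : ℝ)))) x := by
      intro x
      rw [Pi.mul_apply]
      by_cases h0 : 0 ≤ x
      · by_cases h1 : x ≤ w
        · rw [Set.indicator_of_mem (Set.mem_Icc.2 ⟨h0, h1⟩), erlangPDF, if_pos h0,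
            if_pos h1, ← ENNReal.ofReal_mul (by positivity)]
          congr 1
          rw [show -(lam * w) = -(lam * x) + -(lam * (w - x)) by ring, Real.exp_add]
          ring
        · rw [Set.indicator_of_notMem (fun h => h1 h.2), if_neg h1, mul_zero]
      · rw [Set.indicator_of_notMem (fun h => h0 h.1), erlangPDF, if_neg h0]
        simp
    simp_rw [hint]
    rw [lintegral_indicator measurableSet_Icc]
    by_cases hw : 0 ≤ w
    · rw [setLIntegral_Icc_mul_pow_div_factorial (by positivity) hw, if_pos hw]
    · rw [Set.Icc_eq_empty hw, if_neg hw]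
      simp

/-! ### Joint law of two disjoint families of waiting times. -/

section Independent

variable {Ω : Type*} [MeasurableSpace Ω] {P : Measure Ω} [IsProbabilityMeasure P] {lam : ℝ}
  {τ : ℕ → Ω → ℝ}

theorem map_sum_eq_erlangMeasure (hlam : 0 < lam) (hm : ∀ n, Measurable (τ n))
    (hlaw : ∀ n, P.map (τ n) = expMeasure lam) (hind : iIndepFun τ P) (S : Finset ℕ) :
    P.map (fun ω => ∑ i ∈ S, τ i ω) = erlangMeasure lam S.card := by
  have hsum : ∀ S : Finset ℕ, (fun ω => ∑ i ∈ S, τ i ω) = ∑ i ∈ S, τ i := fun S => by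
    ext ω; simp
  rw [hsum]
  induction S using Finset.induction_on with
  | empty =>
    rw [Finset.sum_empty, Finset.card_empty, erlangMeasure]
    change P.map (fun _ => (0 : ℝ)) = _
    rw [Measure.map_const]
    simp
  | insert i S hi ih =>
    have hmS : Measurable (∑ j ∈ S, τ j) := by
      rw [← hsum]
      exact Finset.measurable_sum _ fun j _ => hm j
    rw [Finset.sum_insert hi, add_comm,
      (hind.indepFun_finsetSum_of_notMem hm hi).map_add_eq_map_conv_map hmS (hm i), ih, hlaw, Finset.card_insert_of_notMem hi,
      erlangMeasure_conv_expMeasure hlam]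

/-- The law of the sum of one family of waiting times, on the event that the complementary time
up to `t` is covered by exactly the waiting times of a second family. -/
theorem measure_sum_mem_and_sum_le_lt (hlam : 0 < lam) (hm : ∀ n, Measurable (τ n))
    (hlaw : ∀ n, P.map (τ n) = expMeasure lam) (hind : iIndepFun τ P) {S T : Finset ℕ}
    (hST : Disjoint S T) {m : ℕ} (hmS : m ∉ S) (hmT : m ∉ T) {k : ℕ} (hk : S.card = k + 1)
    (t : ℝ) {A : Set ℝ} (hA : MeasurableSet A) :
    P {ω | ∑ i ∈ S, τ i ω ∈ A ∧ ∑ i ∈ T, τ i ω ≤ t - ∑ i ∈ S, τ i ω ∧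
        t - ∑ i ∈ S, τ i ω < ∑ i ∈ T, τ i ω + τ m ω} =
      ∫⁻ u in A ∩ Set.Icc 0 t, ENNReal.ofReal (lam ^ (k + 1 + T.card) * Real.exp (-(lam * t)) *
        (u ^ k / (k.factorial : ℝ)) * ((t - u) ^ T.card / (T.card.factorial : ℝ))) := by
  have := isProbabilityMeasure_expMeasure hlam
  have := isProbabilityMeasure_erlangMeasure hlam T.card
  have hmsum : ∀ S : Finset ℕ, Measurable fun ω => ∑ i ∈ S, τ i ω := fun S =>
    Finset.measurable_sum _ fun i _ => hm i
  have hFm : IndepFun (fun ω => ∑ i ∈ T, τ i ω) (τ m) P := by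
    have := hind.indepFun_finsetSum_of_notMem hm hmT
    convert this using 1
    ext ω; simp
  have hd : Disjoint S (insert m T) := by
    rw [Finset.disjoint_insert_right]; exact ⟨hmS, hST⟩
  have hEF : IndepFun (fun ω => ∑ i ∈ S, τ i ω) (fun ω => (∑ i ∈ T, τ i ω, τ m ω)) P := by
    have h1 := (hind.indepFun_finset S (insert m T) hd hm).comp
      (φ := fun v : S → ℝ => ∑ i : S, v i)
      (ψ := fun v : ↥(insert m T) → ℝ =>
        (∑ i : T, v ⟨i, Finset.mem_insert_of_mem i.2⟩, v ⟨m, Finset.mem_insert_self m T⟩))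
      (by fun_prop) (by fun_prop)
    convert h1 using 1
    · ext ω
      simp only [Function.comp]
      exact (Finset.sum_coe_sort S (fun i => τ i ω)).symm
    · ext ω
      · simp only [Function.comp]
        exact (Finset.sum_coe_sort T (fun i => τ i ω)).symm
      · rfl
  have hmp : Measurable fun ω => (∑ i ∈ T, τ i ω, τ m ω) := (hmsum T).prodMk (hm m)
  have hlaw3 : P.map (fun ω => (∑ i ∈ S, τ i ω, (∑ i ∈ T, τ i ω, τ m ω))) =
      (erlangMeasure lam (k + 1)).prod ((erlangMeasure lam T.card).prod (expMeasure lam)) := by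
    rw [(indepFun_iff_map_prod_eq_prod_map_map (hmsum S).aemeasurable hmp.aemeasurable).1 hEF,
      (indepFun_iff_map_prod_eq_prod_map_map (hmsum T).aemeasurable (hm m).aemeasurable).1 hFm,
      map_sum_eq_erlangMeasure hlam hm hlaw hind, map_sum_eq_erlangMeasure hlam hm hlaw hind, hlaw,
      hk]
  have hset : MeasurableSet {q : ℝ × ℝ × ℝ | q.1 ∈ A ∧ q.2.1 ≤ t - q.1 ∧
      t - q.1 < q.2.1 + q.2.2} := by
    refine (measurable_fst hA).inter (MeasurableSet.inter ?_ ?_)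
    · exact measurableSet_le measurable_snd.fst (measurable_const.sub measurable_fst)
    · exact measurableSet_lt (measurable_const.sub measurable_fst)
        (measurable_snd.fst.add measurable_snd.snd)
  have hmap := Measure.map_apply (μ := P) ((hmsum S).prodMk hmp) hset
  rw [hlaw3, Measure.prod_apply hset] at hmap
  refine hmap.symm.trans ?_
  -- For a fixed value u of the sum over S, what remains is the Poisson probability of `T.card`
  -- renewals in time t - u.
  have hsec : ∀ u : ℝ, ((erlangMeasure lam T.card).prod (expMeasure lam))
      (Prod.mk u ⁻¹' {q : ℝ × ℝ × ℝ | q.1 ∈ A ∧ q.2.1 ≤ t - q.1 ∧ t - q.1 < q.2.1 + q.2.2}) =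
      A.indicator (fun u => ENNReal.ofReal (if 0 ≤ t - u then lam ^ T.card *
        Real.exp (-(lam * (t - u))) * ((t - u) ^ T.card / (T.card.factorial : ℝ)) else 0)) u := by
    intro u
    by_cases hu : u ∈ A
    · rw [Set.indicator_of_mem hu, ← erlangMeasure_prod_expMeasure_le_lt hlam]
      congr 1
      ext q
      simp [hu]
    · simp [hu]
  simp_rw [hsec]
  have hmeas : Measurable (A.indicator (fun u => ENNReal.ofReal (if 0 ≤ t - u then lam ^ T.card *
      Real.exp (-(lam * (t - u))) * ((t - u) ^ T.card / (T.card.factorial : ℝ)) else 0))) := by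
    refine Measurable.indicator (ENNReal.measurable_ofReal.comp
      (Measurable.ite ?_ (by fun_prop) measurable_const)) hA
    exact measurableSet_le measurable_const (by fun_prop)
  rw [erlangMeasure, lintegral_withDensity_eq_lintegral_mul _ (measurable_erlangPDF _ _) hmeas,
    ← lintegral_indicator (hA.inter measurableSet_Icc)]
  refine lintegral_congr fun u => ?_
  rw [Pi.mul_apply]
  by_cases hu : u ∈ A
  · by_cases h0 : 0 ≤ u
    · by_cases h1 : u ≤ t
      · have h2 : 0 ≤ t - u := by linarith
        rw [Set.indicator_of_mem (s := A) hu, Set.indicator_of_mem (show u ∈ A ∩ Set.Icc 0 t from ⟨hu, h0, h1⟩), erlangPDF, if_pos h0,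
          if_pos h2, ← ENNReal.ofReal_mul (by positivity)]
        congr 1
        rw [show -(lam * t) = -(lam * u) + -(lam * (t - u)) by ring, Real.exp_add]
        ring
      · rw [Set.indicator_of_mem (s := A) hu, Set.indicator_of_notMem (s := A ∩ Set.Icc 0 t) (fun h => h1 h.2.2),
          if_neg (by linarith)]
        simp
    · rw [Set.indicator_of_notMem (s := A ∩ Set.Icc 0 t) (fun h => h0 h.2.1), erlangPDF, if_neg h0]
      simp
  · rw [Set.indicator_of_notMem (s := A) hu,
      Set.indicator_of_notMem (s := A ∩ Set.Icc 0 t) (fun h => hu h.1), mul_zero]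

end Independent

/-! ### Directions on the side x + y = ct. -/

theorem dirX_values : dirX 0 = 1 ∧ dirX 1 = 0 ∧ dirX 2 = -1 ∧ dirX 3 = 0 := by
  refine ⟨?_, ?_, ?_, ?_⟩ <;> simp only [dirX]
  · simp
  · simp
  · have : Real.pi * ((2 : Fin 4) : ℕ) / 2 = Real.pi := by
      rw [show ((2 : Fin 4) : ℕ) = 2 from rfl]; push_cast; ring
    rw [this, Real.cos_pi]
  · have : Real.pi * ((3 : Fin 4) : ℕ) / 2 = Real.pi + Real.pi / 2 := by
      rw [show ((3 : Fin 4) : ℕ) = 3 from rfl]; push_cast; ring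
    rw [this, Real.cos_add]; simp

theorem dirY_values : dirY 0 = 0 ∧ dirY 1 = 1 ∧ dirY 2 = 0 ∧ dirY 3 = -1 := by
  refine ⟨?_, ?_, ?_, ?_⟩ <;> simp only [dirY]
  · simp
  · simp
  · have : Real.pi * ((2 : Fin 4) : ℕ) / 2 = Real.pi := by
      rw [show ((2 : Fin 4) : ℕ) = 2 from rfl]; push_cast; ring
    rw [this, Real.sin_pi]
  · have : Real.pi * ((3 : Fin 4) : ℕ) / 2 = Real.pi + Real.pi / 2 := by
      rw [show ((3 : Fin 4) : ℕ) = 3 from rfl]; push_cast; ring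
    rw [this, Real.sin_add]; simp

theorem dirX_add_dirY_le_one (i : Fin 4) : dirX i + dirY i ≤ 1 := by
  obtain ⟨a0, a1, a2, a3⟩ := dirX_values
  obtain ⟨b0, b1, b2, b3⟩ := dirY_values
  fin_cases i <;> simp [*]

theorem dirX_add_dirY_eq_one_iff (i : Fin 4) : dirX i + dirY i = 1 ↔ i = 0 ∨ i = 1 := by
  obtain ⟨a0, a1, a2, a3⟩ := dirX_values
  obtain ⟨b0, b1, b2, b3⟩ := dirY_values
  fin_cases i <;> simp [*] <;> norm_num

/-- The sequence of directions `d₀, d₁, d₀, d₁, …`. -/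
def alternatingDir (m : ℕ) : Fin 4 := if Even m then 0 else 1

theorem dirX_add_dirY_alternatingDir (m : ℕ) :
    dirX (alternatingDir m) + dirY (alternatingDir m) = 1 := by
  rw [dirX_add_dirY_eq_one_iff, alternatingDir]
  split_ifs <;> simp

theorem dirX_sub_dirY_alternatingDir (m : ℕ) :
    dirX (alternatingDir m) - dirY (alternatingDir m) = (-1) ^ m := by
  obtain ⟨a0, a1, -, -⟩ := dirX_values
  obtain ⟨b0, b1, -, -⟩ := dirY_values
  rw [alternatingDir]
  split_ifs with h
  · rw [h.neg_one_pow, a0, b0, sub_zero]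
  · rw [(Nat.not_even_iff_odd.1 h).neg_one_pow, a1, b1, zero_sub]

/-- From d₀ to d₁ is a counterclockwise turn of a horizontal direction, from d₁ to d₀ a clockwise
turn of a vertical one; the model gives both the same probability. -/
theorem turnProb_alternatingDir (p : ℝ) (m : ℕ) :
    turnProb p (alternatingDir m) (alternatingDir (m + 1)) = p := by
  rcases Nat.even_or_odd m with h | h
  · rw [alternatingDir, alternatingDir, if_pos h, if_neg (by simpa [Nat.even_add_one] using h)]
    simp [turnProb]
  · have h' := Nat.not_even_iff_odd.2 h
    rw [alternatingDir, alternatingDir, if_neg h', if_pos (by simpa [Nat.even_add_one] using h)]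
    simp [turnProb]

theorem turnProb_self (p : ℝ) (i : Fin 4) : turnProb p i i = 0 := by
  fin_cases i <;> simp [turnProb]

theorem eq_alternatingDir_of_ne {x : ℕ → Fin 4} {n : ℕ} (h01 : ∀ k ≤ n, x k = 0 ∨ x k = 1)
    (hne : ∀ k, x k ≠ x (k + 1)) : ∃ j : Fin 2, ∀ k ≤ n, x k = alternatingDir (k + j) := by
  have hstep : ∀ j : ℕ, x 0 = alternatingDir (0 + j) → ∀ k ≤ n, x k = alternatingDir (k + j) := by
    intro j h0 k
    induction k with
    | zero => exact fun _ => h0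
    | succ k ih =>
      intro hk
      have h1 := ih (by omega)
      have h2 := hne k
      have h3 := h01 (k + 1) hk
      rw [h1] at h2
      rw [show k + 1 + j = (k + j) + 1 by ring]
      simp only [alternatingDir, Nat.even_add_one] at h2 ⊢
      by_cases he : Even (k + j)
      · rw [if_pos he] at h2
        rw [if_neg (by simpa using he)]
        tauto
      · rw [if_neg he] at h2
        rw [if_pos he]
        tauto
  rcases h01 0 (Nat.zero_le _) with h | h
  · exact ⟨0, hstep 0 (by simp [alternatingDir, h])⟩
  · exact ⟨1, hstep 1 (by simp [alternatingDir, h])⟩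

/-! ### Splitting the waiting times by parity. -/

/-- The indices `i < n` with `n - i` odd. -/
def oddGap (n : ℕ) : Finset ℕ := (Finset.range n).filter fun i => Odd (n + i)

/-- The indices `i < n` with `n - i` even. -/
def evenGap (n : ℕ) : Finset ℕ := (Finset.range n).filter fun i => ¬ Odd (n + i)

/-- One more switch exchanges the two classes, and the wait just completed belongs to the direction
that is no longer the last. -/
theorem oddGap_succ (n : ℕ) : oddGap (n + 1) = insert n (evenGap n) := by
  ext i
  simp only [oddGap, evenGap, Finset.mem_filter, Finset.mem_range, Finset.mem_insert]
  grind

theorem evenGap_succ (n : ℕ) : evenGap (n + 1) = oddGap n := by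
  ext i
  simp only [oddGap, evenGap, Finset.mem_filter, Finset.mem_range]
  grind

theorem notMem_evenGap (n : ℕ) : n ∉ evenGap n := by simp [evenGap]

theorem notMem_oddGap (n : ℕ) : n ∉ oddGap n := by simp [oddGap]

theorem disjoint_oddGap_evenGap (n : ℕ) : Disjoint (oddGap n) (evenGap n) :=
  Finset.disjoint_filter_filter_not _ _ _

theorem card_oddGap_evenGap (n : ℕ) :
    (oddGap n).card = (n + 1) / 2 ∧ (evenGap n).card = n / 2 := by
  induction n with
  | zero => simp [oddGap, evenGap]
  | succ n ih =>
    rw [oddGap_succ, evenGap_succ, Finset.card_insert_of_notMem (notMem_evenGap n), ih.1, ih.2]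
    omega

theorem sum_oddGap_add_sum_evenGap (v : ℕ → ℝ) (n : ℕ) :
    ∑ i ∈ oddGap n, v i + ∑ i ∈ evenGap n, v i = ∑ i ∈ Finset.range n, v i :=
  Finset.sum_filter_add_sum_filter_not _ _ _

/-- Relative to the last sign, term k counts positively when n - k is even and negatively when it is
odd. The even waits and the remainder together make up r minus the odd waits. -/
theorem sum_mul_neg_one_pow (v : ℕ → ℝ) (n j : ℕ) (r : ℝ) :
    ∑ k ∈ Finset.range n, v k * (-1) ^ (k + j) + (r - ∑ k ∈ Finset.range n, v k) * (-1) ^ (n + j) =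
      (-1) ^ (n + j) * (r - 2 * ∑ k ∈ oddGap n, v k) := by
  have h : ∑ k ∈ Finset.range n, v k * (-1) ^ (k + j) =
      (-1) ^ (n + j) * (∑ k ∈ evenGap n, v k - ∑ k ∈ oddGap n, v k) := by
    rw [← Finset.sum_filter_add_sum_filter_not (Finset.range n) (fun i => Odd (n + i)),
      ← oddGap, ← evenGap, mul_sub, Finset.mul_sum, Finset.mul_sum, add_comm, sub_eq_add_neg,
      ← Finset.sum_neg_distrib]
    congr 1
    · refine Finset.sum_congr rfl fun i hi => ?_
      have : Even (n + i) := Nat.not_odd_iff_even.1 (Finset.mem_filter.1 hi).2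
      rw [mul_comm, pow_add, pow_add _ n]
      rw [Nat.even_add] at this
      congr 2
      rcases Nat.even_or_odd n with h | h
      · rw [h.neg_one_pow, (this.1 h).neg_one_pow]
      · rw [h.neg_one_pow, (Nat.not_even_iff_odd.1 fun h' =>
          Nat.not_even_iff_odd.2 h (this.2 h')).neg_one_pow]
    · refine Finset.sum_congr rfl fun i hi => ?_
      have h2 : (-1 : ℝ) ^ (n + i) = -1 := (Finset.mem_filter.1 hi).2.neg_one_pow
      have h3 : (-1 : ℝ) ^ i * (-1) ^ i = 1 := by rw [← mul_pow]; simp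
      have h4 : (-1 : ℝ) ^ n = -(-1) ^ i := by
        rw [pow_add] at h2
        linear_combination (-1 : ℝ) ^ i * h2 - (-1 : ℝ) ^ n * h3
      rw [pow_add, pow_add _ n, h4]
      ring
  rw [h, ← sum_oddGap_add_sum_evenGap]
  ring

/-! ### The position along a single path. -/

section Path

variable {Ω : Type*} {τ : ℕ → Ω → ℝ} {ξ : ℕ → Ω → Fin 4} {ω : Ω}

theorem switchTime_zero : switchTime τ 0 ω = 0 := by simp [switchTime]

theorem switchTime_succ (n : ℕ) : switchTime τ (n + 1) ω = switchTime τ n ω + τ n ω := by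
  simp [switchTime, Finset.sum_range_succ]

theorem strictMono_switchTime (hpos : ∀ k, 0 < τ k ω) : StrictMono fun n => switchTime τ n ω :=
  strictMono_nat_of_lt_succ fun n => by rw [switchTime_succ]; linarith [hpos n]

theorem switchCount_eq (hpos : ∀ k, 0 < τ k ω) {n : ℕ} {s : ℝ} (h1 : switchTime τ n ω ≤ s)
    (h2 : s < switchTime τ (n + 1) ω) : switchCount τ s ω = n := by
  have hmono := strictMono_switchTime hpos
  have : {m : ℕ | switchTime τ (m + 1) ω ≤ s} = (Finset.range n : Set ℕ) := by
    ext m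
    simp only [Set.mem_ofPred_eq, Finset.coe_range, Set.mem_Iio]
    constructor
    · intro h
      have := hmono.lt_iff_lt.1 (h.trans_lt h2)
      omega
    · intro h
      exact (hmono.monotone (Nat.succ_le_of_lt h)).trans h1
  rw [switchCount, this, Set.ncard_coe_finset, Finset.card_range]

theorem exists_switchTime_le_lt {t : ℝ} (ht : 0 ≤ t) (h : ∃ n, t < switchTime τ (n + 1) ω) :
    ∃ n, switchTime τ n ω ≤ t ∧ t < switchTime τ (n + 1) ω := by
  classical
  refine ⟨Nat.find h, ?_, Nat.find_spec h⟩
  rcases Nat.eq_zero_or_pos (Nat.find h) with h0 | h0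
  · rw [h0, switchTime_zero]; exact ht
  · have := Nat.find_min h (Nat.sub_lt h0 one_pos)
    rw [not_lt, Nat.sub_add_cancel (show 1 ≤ Nat.find h from h0)] at this
    exact this

theorem intervalIntegral_direction (hpos : ∀ k, 0 < τ k ω) (f : Fin 4 → ℝ) {n : ℕ} {b : ℝ}
    (h1 : switchTime τ n ω ≤ b) (h2 : b ≤ switchTime τ (n + 1) ω) :
    IntervalIntegrable (fun s => f (direction τ ξ s ω)) volume (switchTime τ n ω) b ∧
      ∫ s in (switchTime τ n ω)..b, f (direction τ ξ s ω) =
        (b - switchTime τ n ω) * f (ξ n ω) := by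
  -- The open interval is used because the direction may already have changed at b; one point does
  -- not affect the integral.
  have hconst : Set.EqOn (fun _ : ℝ => f (ξ n ω)) (fun s => f (direction τ ξ s ω))
      (Set.Ioo (switchTime τ n ω) b) := fun s hs => by
    simp only [direction]
    rw [switchCount_eq hpos hs.1.le (hs.2.trans_le h2)]
  constructor
  · rw [intervalIntegrable_iff_integrableOn_Ioo_of_le h1]
    exact (integrableOn_const (by simp)).congr_fun hconst measurableSet_Ioo
  · rw [intervalIntegral.integral_of_le h1, integral_Ioc_eq_integral_Ioo,
      ← setIntegral_congr_fun measurableSet_Ioo hconst, setIntegral_const, smul_eq_mul]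
    simp [h1]

theorem integral_direction (hpos : ∀ k, 0 < τ k ω) (f : Fin 4 → ℝ) {n : ℕ} {t : ℝ}
    (h1 : switchTime τ n ω ≤ t) (h2 : t < switchTime τ (n + 1) ω) :
    ∫ s in (0 : ℝ)..t, f (direction τ ξ s ω) =
      ∑ k ∈ Finset.range n, τ k ω * f (ξ k ω) + (t - switchTime τ n ω) * f (ξ n ω) := by
  have hk : ∀ k, _ := fun k => intervalIntegral_direction (ξ := ξ) hpos f
    ((strictMono_switchTime hpos).monotone (Nat.le_succ k)) le_rfl
  have hn := intervalIntegral_direction (ξ := ξ) hpos f h1 h2.le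
  have hsum := intervalIntegral.sum_integral_adjacent_intervals (a := fun n => switchTime τ n ω)
    (n := n) (μ := volume) fun k _ => (hk k).1
  have hint := IntervalIntegrable.trans_iterate (a := fun n => switchTime τ n ω)
    (n := n) (μ := volume) fun k _ => (hk k).1
  rw [switchTime_zero] at hsum hint
  rw [← intervalIntegral.integral_add_adjacent_intervals hint hn.1, hn.2, ← hsum]
  congr 1
  refine Finset.sum_congr rfl fun k _ => ?_
  rw [(hk k).2, switchTime_succ]
  ring

/-- On the event of `n` switches up to time `t`, the particle is on the side `x + y = ct` of the
boundary exactly when its directions alternate between `d₀` and `d₁`. -/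
theorem posX_add_posY_eq_iff {c t : ℝ} (hc : 0 < c) (hpos : ∀ k, 0 < τ k ω)
    (hne : ∀ k, ξ k ω ≠ ξ (k + 1) ω) {n : ℕ}
    (h1 : switchTime τ n ω < t) (h2 : t < switchTime τ (n + 1) ω) :
    posX c τ ξ t ω + posY c τ ξ t ω = c * t ↔
      ∃ j : Fin 2, ∀ k ≤ n, ξ k ω = alternatingDir (k + j) := by
  have hX := integral_direction (ξ := ξ) hpos (fun i => c * dirX i) h1.le h2
  have hY := integral_direction (ξ := ξ) hpos (fun i => c * dirY i) h1.le h2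
  -- The deficit is a sum of nonnegative terms weighted by durations. All durations are positive,
  -- the last because of the strict inequality in `h1`, so zero deficit forces each factor to
  -- vanish.
  have hdef : c * t - (posX c τ ξ t ω + posY c τ ξ t ω) =
      c * (∑ k ∈ Finset.range n, τ k ω * (1 - (dirX (ξ k ω) + dirY (ξ k ω))) +
        (t - switchTime τ n ω) * (1 - (dirX (ξ n ω) + dirY (ξ n ω)))) := by
    have hs : ∑ k ∈ Finset.range n, τ k ω * (1 - (dirX (ξ k ω) + dirY (ξ k ω))) =
        switchTime τ n ω - (∑ k ∈ Finset.range n, τ k ω * dirX (ξ k ω) +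
          ∑ k ∈ Finset.range n, τ k ω * dirY (ξ k ω)) := by
      rw [switchTime, ← Finset.sum_add_distrib, ← Finset.sum_sub_distrib]
      exact Finset.sum_congr rfl fun k _ => by ring
    have hm : ∀ g : Fin 4 → ℝ, ∑ k ∈ Finset.range n, τ k ω * (c * g (ξ k ω)) =
        c * ∑ k ∈ Finset.range n, τ k ω * g (ξ k ω) := fun g => by
      rw [Finset.mul_sum]
      exact Finset.sum_congr rfl fun k _ => by ring
    rw [posX, posY, hX, hY, hs, hm, hm]
    ring
  constructor
  · intro h
    rw [h, sub_self, eq_comm, mul_eq_zero, or_iff_right hc.ne'] at hdef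
    have hterm : ∀ k, 0 ≤ τ k ω * (1 - (dirX (ξ k ω) + dirY (ξ k ω))) := fun k =>
      mul_nonneg (hpos k).le (sub_nonneg.2 (dirX_add_dirY_le_one _))
    have hlast : 0 ≤ (t - switchTime τ n ω) * (1 - (dirX (ξ n ω) + dirY (ξ n ω))) :=
      mul_nonneg (sub_pos.2 h1).le (sub_nonneg.2 (dirX_add_dirY_le_one _))
    obtain ⟨hz1, hz2⟩ := (add_eq_zero_iff_of_nonneg
      (Finset.sum_nonneg fun k _ => hterm k) hlast).1 hdef
    refine eq_alternatingDir_of_ne (x := fun k => ξ k ω) (fun k hk => ?_) hne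
    rw [← dirX_add_dirY_eq_one_iff]
    rcases hk.lt_or_eq with hlt | rfl
    · have := (Finset.sum_eq_zero_iff_of_nonneg fun k _ => hterm k).1 hz1 k
        (Finset.mem_range.2 hlt)
      rw [mul_eq_zero, or_iff_right (hpos k).ne'] at this
      linarith
    · rw [mul_eq_zero, or_iff_right (sub_pos.2 h1).ne'] at hz2
      linarith
  · rintro ⟨j, hj⟩
    have hz : ∑ k ∈ Finset.range n, τ k ω * (1 - (dirX (ξ k ω) + dirY (ξ k ω))) = 0 :=
      Finset.sum_eq_zero fun k hk => by
        rw [hj k (Finset.mem_range.1 hk).le, dirX_add_dirY_alternatingDir]; ring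
    rw [hz, hj n le_rfl, dirX_add_dirY_alternatingDir] at hdef
    linarith

theorem posX_sub_posY_eq {c t : ℝ} (hpos : ∀ k, 0 < τ k ω) {n j : ℕ}
    (h1 : switchTime τ n ω ≤ t) (h2 : t < switchTime τ (n + 1) ω)
    (hj : ∀ k ≤ n, ξ k ω = alternatingDir (k + j)) :
    posX c τ ξ t ω - posY c τ ξ t ω =
      c * ((-1) ^ (n + j) * (t - 2 * ∑ k ∈ oddGap n, τ k ω)) := by
  rw [posX, posY, integral_direction (ξ := ξ) hpos (fun i => c * dirX i) h1 h2,
    integral_direction (ξ := ξ) hpos (fun i => c * dirY i) h1 h2,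
    ← sum_mul_neg_one_pow, hj n le_rfl, ← dirX_sub_dirY_alternatingDir, mul_add, Finset.mul_sum,
    ← switchTime]
  have : ∑ k ∈ Finset.range n, c * (τ k ω * (-1) ^ (k + j)) =
      ∑ k ∈ Finset.range n, τ k ω * (c * dirX (ξ k ω)) -
        ∑ k ∈ Finset.range n, τ k ω * (c * dirY (ξ k ω)) := by
    rw [← Finset.sum_sub_distrib]
    refine Finset.sum_congr rfl fun k hk => ?_
    rw [hj k (Finset.mem_range.1 hk).le, ← dirX_sub_dirY_alternatingDir]
    ring
  rw [this]
  ring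

end Path

/-! ### Null events and probabilities of alternating paths. -/

theorem expMeasure_Iic_zero {lam : ℝ} (hlam : 0 < lam) : expMeasure lam (Set.Iic 0) = 0 := by
  rw [expMeasure_eq_withDensity, withDensity_apply _ measurableSet_Iic,
    lintegral_exponentialPDF_eq_antiDeriv hlam]
  simp

theorem erlangMeasure_succ_singleton (lam : ℝ) (k : ℕ) (t : ℝ) :
    erlangMeasure lam (k + 1) {t} = 0 :=
  withDensity_absolutelyContinuous _ _ (measure_singleton t)

/-- Bounding the exponential by 1 gives a bound that tends to 0 with k, which rules out infinitely
many switches before t. -/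
theorem erlangMeasure_succ_Iic_le {lam t : ℝ} (hlam : 0 < lam) (ht : 0 ≤ t) (k : ℕ) :
    erlangMeasure lam (k + 1) (Set.Iic t) ≤
      ENNReal.ofReal (lam ^ (k + 1) * (t ^ (k + 1) / ((k + 1).factorial : ℝ))) := by
  rw [← setLIntegral_Icc_mul_pow_div_factorial (by positivity) ht, erlangMeasure,
    withDensity_apply _ measurableSet_Iic, ← lintegral_indicator measurableSet_Iic,
    ← lintegral_indicator measurableSet_Icc]
  refine lintegral_mono fun x => ?_
  by_cases hx : x ∈ Set.Iic t
  · rw [Set.indicator_of_mem hx, erlangPDF]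
    by_cases h0 : 0 ≤ x
    · rw [if_pos h0, Set.indicator_of_mem (Set.mem_Icc.2 ⟨h0, hx⟩)]
      refine ENNReal.ofReal_le_ofReal ?_
      have : Real.exp (-(lam * x)) ≤ 1 := Real.exp_le_one_iff.2 (by nlinarith)
      refine mul_le_mul_of_nonneg_right ?_ (by positivity)
      exact mul_le_of_le_one_right (by positivity) this
    · simp [h0]
  · simp [hx]

section AlternatingEvent

variable {Ω : Type*} {τ : ℕ → Ω → ℝ} {ξ : ℕ → Ω → Fin 4}

/-- The event that the directions alternate from `d_j` through exactly `n` switches up to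
time `t`, with the time spent in the directions other than the last one lying in `A`. -/
def alternatingEvent (τ : ℕ → Ω → ℝ) (ξ : ℕ → Ω → Fin 4) (t : ℝ) (n j : ℕ) (A : Set ℝ) :
    Set Ω :=
  {ω | ∀ k ≤ n, ξ k ω = alternatingDir (k + j)} ∩
    {ω | ∑ i ∈ oddGap n, τ i ω ∈ A ∧ ∑ i ∈ evenGap n, τ i ω ≤ t - ∑ i ∈ oddGap n, τ i ω ∧
      t - ∑ i ∈ oddGap n, τ i ω < ∑ i ∈ evenGap n, τ i ω + τ n ω}

theorem mem_alternatingEvent_iff {t : ℝ} {n j : ℕ} {A : Set ℝ} {ω : Ω} :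
    ω ∈ alternatingEvent τ ξ t n j A ↔ (∀ k ≤ n, ξ k ω = alternatingDir (k + j)) ∧
      ∑ i ∈ oddGap n, τ i ω ∈ A ∧ switchTime τ n ω ≤ t ∧ t < switchTime τ (n + 1) ω := by
  rw [switchTime_succ, switchTime, ← sum_oddGap_add_sum_evenGap (fun i => τ i ω)]
  simp only [alternatingEvent, Set.mem_inter_iff, Set.mem_ofPred_eq]
  constructor
  · rintro ⟨h1, h2, h3, h4⟩
    exact ⟨h1, h2, by linarith, by linarith⟩
  · rintro ⟨h1, h2, h3, h4⟩
    exact ⟨h1, h2, by linarith, by linarith⟩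

end AlternatingEvent

section Law

variable {Ω : Type*} [MeasurableSpace Ω] {P : Measure Ω} {lam p : ℝ} {τ : ℕ → Ω → ℝ} {ξ : ℕ → Ω → Fin 4}

theorem IsPlanarMotion.map_switchTime [IsProbabilityMeasure P]
    (h : IsPlanarMotion P lam p τ ξ) (hlam : 0 < lam) (n : ℕ) :
    P.map (switchTime τ n) = erlangMeasure lam n := by
  have := map_sum_eq_erlangMeasure hlam h.measurable_wait h.wait_law h.wait_indep (Finset.range n)
  rwa [Finset.card_range] at this

theorem IsPlanarMotion.measurable_switchTime (h : IsPlanarMotion P lam p τ ξ) (n : ℕ) :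
    Measurable (switchTime τ n) :=
  Finset.measurable_sum _ fun i _ => h.measurable_wait i

theorem IsPlanarMotion.ae_wait_pos (h : IsPlanarMotion P lam p τ ξ) (hlam : 0 < lam) :
    ∀ᵐ ω ∂P, ∀ k, 0 < τ k ω := by
  rw [ae_all_iff]
  intro k
  have := Measure.map_apply (μ := P) (h.measurable_wait k) (measurableSet_Iic (a := (0 : ℝ)))
  rw [h.wait_law, expMeasure_Iic_zero hlam] at this
  rw [ae_iff]
  convert this.symm using 2
  ext ω
  simp

theorem IsPlanarMotion.ae_switchTime_ne [IsProbabilityMeasure P]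
    (h : IsPlanarMotion P lam p τ ξ) (hlam : 0 < lam)
    {t : ℝ} (ht : 0 < t) : ∀ᵐ ω ∂P, ∀ n, switchTime τ n ω ≠ t := by
  rw [ae_all_iff]
  intro n
  cases n with
  | zero => exact Filter.Eventually.of_forall fun ω => by rw [switchTime_zero]; exact ht.ne
  | succ n =>
    have := Measure.map_apply (μ := P) (h.measurable_switchTime (n + 1))
      (measurableSet_singleton t)
    rw [h.map_switchTime hlam, erlangMeasure_succ_singleton] at this
    rw [ae_iff]
    convert this.symm using 2
    ext ω
    simp

theorem IsPlanarMotion.ae_exists_lt_switchTime [IsProbabilityMeasure P]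
    (h : IsPlanarMotion P lam p τ ξ) (hlam : 0 < lam)
    {t : ℝ} (ht : 0 ≤ t) : ∀ᵐ ω ∂P, ∃ n, t < switchTime τ (n + 1) ω := by
  rw [ae_iff]
  have hle : ∀ n : ℕ, P {ω | ¬ ∃ n, t < switchTime τ (n + 1) ω} ≤
      ENNReal.ofReal (lam ^ (n + 1) * (t ^ (n + 1) / ((n + 1).factorial : ℝ))) := by
    intro n
    refine le_trans ?_ (erlangMeasure_succ_Iic_le hlam ht n)
    rw [← h.map_switchTime hlam, Measure.map_apply (h.measurable_switchTime (n + 1))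
      measurableSet_Iic]
    refine measure_mono fun ω hω => ?_
    simp only [Set.mem_ofPred_eq, not_exists, not_lt] at hω
    exact hω n
  have hlim : Filter.Tendsto (fun n : ℕ =>
      ENNReal.ofReal (lam ^ (n + 1) * (t ^ (n + 1) / ((n + 1).factorial : ℝ))))
      Filter.atTop (nhds 0) := by
    rw [← ENNReal.ofReal_zero]
    refine ENNReal.tendsto_ofReal ?_
    have := (FloorSemiring.tendsto_pow_div_factorial_atTop (lam * t)).comp
      (Filter.tendsto_add_atTop_nat 1)
    refine this.congr fun n => ?_
    simp only [Function.comp, mul_pow, mul_div_assoc]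
  exact le_antisymm (ge_of_tendsto' hlim hle) zero_le

theorem IsPlanarMotion.ae_dir_ne [IsProbabilityMeasure P]
    (h : IsPlanarMotion P lam p τ ξ) :
    ∀ᵐ ω ∂P, ∀ k, ξ k ω ≠ ξ (k + 1) ω := by
  rw [ae_all_iff]
  intro k
  -- A repetition at step k means following one of finitely many paths b whose entry k is copied to
  -- k + 1 by `min m k`; each has a factor `turnProb p i i = 0`.
  have hpath : ∀ b : Fin (k + 1) → Fin 4, ∀ᵐ ω ∂P,
      ¬ ∀ m ≤ k + 1, ξ m ω = b ⟨min m k, by omega⟩ := by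
    intro b
    rw [ae_iff]
    simp only [not_not]
    have := h.dir_law (k + 1) fun m => b ⟨min m k, by omega⟩
    rw [Finset.prod_range_succ] at this
    simp only [min_self, Nat.min_eq_right (Nat.le_succ k), turnProb_self, mul_zero] at this
    exact (measureReal_eq_zero_iff).1 this
  filter_upwards [ae_all_iff.2 hpath] with ω hω heq
  refine hω (fun i => ξ i ω) fun m hm => ?_
  rcases Nat.lt_or_ge k m with hlt | hge
  · have : m = k + 1 := by omega
    subst this
    simp [heq.symm]
  · simp [hge]

theorem IsPlanarMotion.measure_alternating [IsProbabilityMeasure P]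
    (h : IsPlanarMotion P lam p τ ξ) (n j : ℕ) :
    P {ω | ∀ k ≤ n, ξ k ω = alternatingDir (k + j)} = ENNReal.ofReal (1 / 4 * p ^ n) := by
  have := h.dir_law n fun k => alternatingDir (k + j)
  have hp : ∏ k ∈ Finset.range n, turnProb p (alternatingDir (k + j))
      (alternatingDir (k + 1 + j)) = p ^ n := by
    rw [← Finset.card_range n, ← Finset.prod_const, Finset.card_range]
    refine Finset.prod_congr rfl fun k _ => ?_
    rw [show k + 1 + j = (k + j) + 1 by ring, turnProb_alternatingDir]
  rw [hp] at this
  rw [← this, ofReal_measureReal]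

/-- The density of the time spent in the directions other than the last one, on the event of
`n + 1` switches up to time `t`. -/
noncomputable def occupationDensity (lam t : ℝ) (n : ℕ) (u : ℝ) : ℝ :=
  lam ^ (n + 1) * Real.exp (-(lam * t)) * (u ^ (n / 2) / ((n / 2).factorial : ℝ)) *
    ((t - u) ^ ((n + 1) / 2) / (((n + 1) / 2).factorial : ℝ))

theorem IsPlanarMotion.measurableSet_alternatingEvent (h : IsPlanarMotion P lam p τ ξ)
    (t : ℝ) (n j : ℕ) {A : Set ℝ} (hA : MeasurableSet A) :
    MeasurableSet (alternatingEvent τ ξ t n j A) := by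
  have hm : ∀ S : Finset ℕ, Measurable fun ω => ∑ i ∈ S, τ i ω := fun S =>
    Finset.measurable_sum _ fun i _ => h.measurable_wait i
  refine MeasurableSet.inter ?_ (((hm _) hA).inter ((measurableSet_le (hm _)
    (measurable_const.sub (hm _))).inter (measurableSet_lt (measurable_const.sub (hm _))
    ((hm _).add (h.measurable_wait n)))))
  simp only [Set.ofPred_forall]
  exact MeasurableSet.iInter fun k => MeasurableSet.iInter fun _ =>
    h.measurable_dir k (measurableSet_singleton _)

theorem IsPlanarMotion.measure_alternatingEvent [IsProbabilityMeasure P]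
    (h : IsPlanarMotion P lam p τ ξ)
    (hlam : 0 < lam) (t : ℝ) (n j : ℕ) {A : Set ℝ} (hA : MeasurableSet A) :
    P (alternatingEvent τ ξ t (n + 1) j A) = ENNReal.ofReal (1 / 4 * p ^ (n + 1)) *
      ∫⁻ u in A ∩ Set.Icc 0 t, ENNReal.ofReal (occupationDensity lam t n u) := by
  obtain ⟨hc1, hc2⟩ := card_oddGap_evenGap (n + 1)
  have hE := measure_sum_mem_and_sum_le_lt hlam h.measurable_wait h.wait_law h.wait_indep
    (disjoint_oddGap_evenGap (n + 1)) (notMem_oddGap _) (notMem_evenGap _)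
    -- With n + 1 switches `oddGap` has n/2 + 1 ≥ 1 elements, so its sum has a density.
    (k := n / 2) (by omega) t hA
  rw [hc2, show n / 2 + 1 + (n + 1) / 2 = n + 1 by omega] at hE
  have hmv : ∀ S : Finset ℕ, Measurable fun v : ℕ → ℝ => ∑ i ∈ S, v i := fun S =>
    Finset.measurable_sum _ fun i _ => measurable_pi_apply i
  have hV : MeasurableSet {v : ℕ → ℝ | ∑ i ∈ oddGap (n + 1), v i ∈ A ∧
      ∑ i ∈ evenGap (n + 1), v i ≤ t - ∑ i ∈ oddGap (n + 1), v i ∧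
      t - ∑ i ∈ oddGap (n + 1), v i < ∑ i ∈ evenGap (n + 1), v i + v (n + 1)} :=
    ((hmv _) hA).inter ((measurableSet_le (hmv _)
    (measurable_const.sub (hmv _))).inter (measurableSet_lt (measurable_const.sub (hmv _))
    ((hmv _).add (measurable_pi_apply _))))
  have hX : MeasurableSet {x : ℕ → Fin 4 | ∀ k ≤ n + 1, x k = alternatingDir (k + j)} := by
    simp only [Set.ofPred_forall]
    exact MeasurableSet.iInter fun k => MeasurableSet.iInter fun _ =>
      measurable_pi_apply k (measurableSet_singleton _)
  have hI := h.wait_dir_indep.measure_inter_preimage_eq_mul _ _ hV hX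
  rw [← h.measure_alternating (n + 1) j]
  simp only [occupationDensity]
  rw [← hE, alternatingEvent, Set.inter_comm, mul_comm]
  exact hI

theorem IsPlanarMotion.ae_mem_iff [IsProbabilityMeasure P]
    (h : IsPlanarMotion P lam p τ ξ) (hlam : 0 < lam) {c t : ℝ}
    (hc : 0 < c) (ht : 0 < t) {B : Set ℝ} (hB : B ⊆ Set.Ioo (-(c * t)) (c * t)) :
    ∀ᵐ ω ∂P, (posX c τ ξ t ω + posY c τ ξ t ω = c * t ∧ posX c τ ξ t ω - posY c τ ξ t ω ∈ B) ↔
      ω ∈ ⋃ q : ℕ × Fin 2, alternatingEvent τ ξ t (q.1 + 1) q.2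
        ((fun u => c * ((-1) ^ (q.1 + 1 + (q.2 : ℕ)) * (t - 2 * u))) ⁻¹' B) := by
  filter_upwards [h.ae_wait_pos hlam, h.ae_switchTime_ne hlam ht, h.ae_exists_lt_switchTime hlam
    ht.le, h.ae_dir_ne] with ω hpos hT hex hne
  simp only [Set.mem_iUnion, mem_alternatingEvent_iff, Set.mem_preimage, Prod.exists]
  constructor
  · rintro ⟨h1, h2⟩
    obtain ⟨n, hn1, hn2⟩ := exists_switchTime_le_lt ht.le hex
    obtain ⟨j, hj⟩ := (posX_add_posY_eq_iff hc hpos hne (lt_of_le_of_ne hn1 (hT n)) hn2).1 h1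
    rw [posX_sub_posY_eq hpos hn1 hn2 hj] at h2
    cases n with
    -- Without a switch X - Y = ±ct, which B excludes.
    | zero =>
      exfalso
      have h3 := hB h2
      have h4 : (-1 : ℝ) ^ (0 + (j : ℕ)) = 1 ∨ (-1 : ℝ) ^ (0 + (j : ℕ)) = -1 :=
        neg_one_pow_eq_or ℝ _
      have h5 : ∑ k ∈ oddGap 0, τ k ω = 0 := by simp [oddGap]
      rw [h5] at h3
      rcases h4 with h4 | h4 <;> rw [h4] at h3
      · have := h3.2
        linarith
      · have := h3.1
        linarith
    | succ n => exact ⟨n, j, hj, h2, hn1, hn2⟩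
  · rintro ⟨n, j, hj, h2, hn1, hn2⟩
    refine ⟨(posX_add_posY_eq_iff hc hpos hne (lt_of_le_of_ne hn1 (hT _)) hn2).2 ⟨j, hj⟩, ?_⟩
    rw [posX_sub_posY_eq hpos hn1 hn2 hj]
    exact h2

/-- When all waits are positive, a path determines its number of switches up to t and its initial
direction, hence the index q. -/
theorem IsPlanarMotion.aedisjoint_alternatingEvent (h : IsPlanarMotion P lam p τ ξ)
    (hlam : 0 < lam) (t : ℝ) (A : ℕ × Fin 2 → Set ℝ) :
    Pairwise (Function.onFun (AEDisjoint P)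
      fun q => alternatingEvent τ ξ t (q.1 + 1) q.2 (A q)) := by
  intro q r hqr
  have hae : ∀ᵐ ω ∂P, ω ∉ alternatingEvent τ ξ t (q.1 + 1) q.2 (A q) ∩
      alternatingEvent τ ξ t (r.1 + 1) r.2 (A r) := by
    filter_upwards [h.ae_wait_pos hlam] with ω hpos
    rintro ⟨hq, hr⟩
    rw [mem_alternatingEvent_iff] at hq hr
    obtain ⟨hq1, -, hq2, hq3⟩ := hq
    obtain ⟨hr1, -, hr2, hr3⟩ := hr
    have hmono := strictMono_switchTime (τ := τ) hpos
    have h1 := hmono.lt_iff_lt.1 (hq2.trans_lt hr3)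
    have h2 := hmono.lt_iff_lt.1 (hr2.trans_lt hq3)
    refine hqr (Prod.ext (by omega) ?_)
    have h3 := (hq1 0 (Nat.zero_le _)).symm.trans (hr1 0 (Nat.zero_le _))
    generalize q.2 = a at h3 ⊢
    generalize r.2 = b at h3 ⊢
    fin_cases a <;> fin_cases b <;> simp [alternatingDir] at h3 ⊢
  rw [ae_iff] at hae
  simpa [Function.onFun, AEDisjoint] using hae

end Law

/-! ### Change of variables and summation of the series. -/

/-- The map u ↦ η has inverse u = (t ∓ η/c)/2, with Jacobian 1/(2c), and |η| < ct places u in [0,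
t]. -/
theorem setLIntegral_affine_preimage {c t : ℝ} (hc : 0 < c) (n : ℕ) {B : Set ℝ}
    (hBm : MeasurableSet B) (hB : B ⊆ Set.Ioo (-(c * t)) (c * t)) (f : ℝ → ENNReal) :
    ∫⁻ u in ((fun u => c * ((-1) ^ n * (t - 2 * u))) ⁻¹' B) ∩ Set.Icc 0 t, f u =
      ∫⁻ η in B, ENNReal.ofReal (1 / (2 * c)) * f ((t - (-1) ^ n * η / c) / 2) := by
  have he : ((-1 : ℝ) ^ n) * (-1) ^ n = 1 := by rw [← mul_pow]; simp
  have hpm : (-1 : ℝ) ^ n = 1 ∨ (-1 : ℝ) ^ n = -1 := neg_one_pow_eq_or ℝ n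
  have himg : (fun η : ℝ => (t - (-1) ^ n * η / c) / 2) '' B =
      ((fun u => c * ((-1) ^ n * (t - 2 * u))) ⁻¹' B) ∩ Set.Icc 0 t := by
    ext u
    simp only [Set.mem_image, Set.mem_inter_iff, Set.mem_preimage, Set.mem_Icc]
    constructor
    · rintro ⟨η, hη, rfl⟩
      have h1 := (hB hη).1
      have h2 := (hB hη).2
      have h3 : -t < η / c := by rw [lt_div_iff₀ hc]; linarith
      have h4 : η / c < t := by rw [div_lt_iff₀ hc]; linarith
      refine ⟨?_, ?_⟩
      · have : c * ((-1) ^ n * (t - 2 * ((t - (-1) ^ n * η / c) / 2))) = η := by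
          field_simp
          linear_combination η * he
        rwa [this]
      · rcases hpm with h | h <;> rw [h, mul_div_assoc] <;> constructor <;> linarith
    · rintro ⟨hu, -⟩
      refine ⟨_, hu, ?_⟩
      field_simp
      linear_combination (-(t - 2 * u)) * he
  have hder : ∀ η ∈ B, HasDerivWithinAt (fun η : ℝ => (t - (-1) ^ n * η / c) / 2)
      (-((-1) ^ n / (2 * c))) B η := by
    intro η _
    have := ((((hasDerivAt_id η).const_mul ((-1) ^ n)).div_const c).const_sub t).div_const 2
    refine HasDerivAt.hasDerivWithinAt (this.congr_deriv ?_)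
    field_simp
  have hinj : Set.InjOn (fun η : ℝ => (t - (-1) ^ n * η / c) / 2) B := by
    intro x _ y _ hxy
    have h1 : (-1 : ℝ) ^ n * x = (-1) ^ n * y := by
      simp only at hxy
      field_simp at hxy
      linarith
    have := congrArg (fun z => (-1 : ℝ) ^ n * z) h1
    simp only [← mul_assoc, he, one_mul] at this
    exact this
  rw [← himg, lintegral_image_eq_lintegral_abs_deriv_mul hBm hder hinj]
  refine lintegral_congr fun η => ?_
  congr 2
  rw [abs_neg, abs_div, abs_pow, abs_neg, abs_one, one_pow, abs_of_pos (by positivity)]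

theorem boundaryDensity_nonneg {c lam p η t : ℝ} (hc : 0 < c) (hlam : 0 ≤ lam) (hp : 0 ≤ p)
    (ht : 0 ≤ t) (h : 0 < c ^ 2 * t ^ 2 - η ^ 2) : 0 ≤ boundaryDensity c lam p η t := by
  have hz : 0 ≤ (lam * p) ^ 2 * ((c ^ 2 * t ^ 2 - η ^ 2) / (4 * c ^ 2)) := by positivity
  have h1 : ∀ z : ℝ, 0 ≤ z → 0 ≤ besselSeries z := fun z hz =>
    tsum_nonneg fun k => by positivity
  have h2 : ∀ z : ℝ, 0 ≤ z → 0 ≤ besselSeriesDeriv z := fun z hz =>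
    tsum_nonneg fun k => by positivity
  have h3 := h1 _ hz
  have h4 := h2 _ hz
  rw [boundaryDensity_eq hc h]
  positivity

theorem hasSum_occupationDensity {c lam p η t : ℝ} (hc : 0 < c)
    (h : 0 < c ^ 2 * t ^ 2 - η ^ 2) :
    HasSum (fun n : ℕ => 1 / 4 * p ^ (n + 1) * (1 / (2 * c)) *
      (occupationDensity lam t n ((t - η / c) / 2) + occupationDensity lam t n ((t + η / c) / 2)))
      (boundaryDensity c lam p η t) := by
  have hsum := summable_besselSeries ((lam * p) ^ 2 * ((c ^ 2 * t ^ 2 - η ^ 2) / (4 * c ^ 2)))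
  have hsum' := summable_besselSeriesDeriv
    ((lam * p) ^ 2 * ((c ^ 2 * t ^ 2 - η ^ 2) / (4 * c ^ 2)))
  have hu : (c ^ 2 * t ^ 2 - η ^ 2) / (4 * c ^ 2) = (t - η / c) / 2 * ((t + η / c) / 2) := by
    field_simp
    ring
  have e1 := hsum.hasSum.mul_left (Real.exp (-lam * t) / (4 * c) * (lam * p))
  have e2 := hsum'.hasSum.mul_left (Real.exp (-lam * t) / (4 * c) * ((lam * p) ^ 2 * t / 2))
  have hs1 : t - (t - η / c) / 2 = (t + η / c) / 2 := by ring
  have hs2 : t - (t + η / c) / 2 = (t - η / c) / 2 := by ring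
  rw [boundaryDensity_eq hc h, mul_add, ← mul_assoc _ (lam * p), ← mul_assoc _ ((lam * p) ^ 2 * t / 2)]
  refine HasSum.even_add_odd ?_ ?_
  · refine e1.congr_fun ?_
    intro k
    simp only [occupationDensity]
    rw [show 2 * k / 2 = k by omega, show (2 * k + 1) / 2 = k by omega, hs1, hs2, hu, mul_pow,
      mul_pow, neg_mul]
    have : (k.factorial : ℝ) ≠ 0 := by exact_mod_cast k.factorial_ne_zero
    generalize (t - η / c) / 2 = x
    generalize (t + η / c) / 2 = y
    field_simp
    ring
  · refine e2.congr_fun ?_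
    intro k
    simp only [occupationDensity]
    rw [show (2 * k + 1) / 2 = k by omega, show (2 * k + 1 + 1) / 2 = k + 1 by omega, hs1, hs2, hu,
      mul_pow, mul_pow, neg_mul]
    have : (k.factorial : ℝ) ≠ 0 := by exact_mod_cast k.factorial_ne_zero
    have : ((k + 1).factorial : ℝ) ≠ 0 := by exact_mod_cast (k + 1).factorial_ne_zero
    -- This identity turns the two mirrored monomials into the factor t.
    have hxy : t = (t - η / c) / 2 + (t + η / c) / 2 := by ring
    generalize (t - η / c) / 2 = x at hxy ⊢
    generalize (t + η / c) / 2 = y at hxy ⊢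
    subst hxy
    field_simp
    ring

theorem sq_sub_sq_pos_of_mem_Ioo {a η : ℝ} (h : η ∈ Set.Ioo (-a) a) : 0 < a ^ 2 - η ^ 2 :=
  sub_pos.2 (sq_lt_sq' h.1 h.2)

theorem occupationDensity_nonneg {lam t u : ℝ} (hlam : 0 ≤ lam) (h0 : 0 ≤ u) (h1 : u ≤ t)
    (n : ℕ) : 0 ≤ occupationDensity lam t n u := by
  have := sub_nonneg.2 h1
  rw [occupationDensity]
  positivity

theorem continuous_occupationDensity (lam t : ℝ) (n : ℕ) :
    Continuous (occupationDensity lam t n) := by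
  unfold occupationDensity
  fun_prop

/-- For each number of switches the two starts give the two signs of η; its parity only decides
their order. -/
theorem ofReal_boundaryDensity {c lam p η t : ℝ} (hc : 0 < c) (hlam : 0 ≤ lam) (hp : 0 ≤ p)
    (hη : η ∈ Set.Ioo (-(c * t)) (c * t)) :
    ∑' q : ℕ × Fin 2, ENNReal.ofReal (1 / 4 * p ^ (q.1 + 1)) * (ENNReal.ofReal (1 / (2 * c)) *
      ENNReal.ofReal (occupationDensity lam t q.1
        ((t - (-1) ^ (q.1 + 1 + (q.2 : ℕ)) * η / c) / 2))) =
      ENNReal.ofReal (boundaryDensity c lam p η t) := by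
  have h3 : -t < η / c := by rw [lt_div_iff₀ hc]; linarith [hη.1]
  have h4 : η / c < t := by rw [div_lt_iff₀ hc]; linarith [hη.2]
  have hpos := sq_sub_sq_pos_of_mem_Ioo hη
  rw [mul_pow] at hpos
  have hS := hasSum_occupationDensity (lam := lam) (p := p) hc hpos
  have hn1 : ∀ n, 0 ≤ occupationDensity lam t n ((t - η / c) / 2) := fun n =>
    occupationDensity_nonneg hlam (by linarith) (by linarith) n
  have hn2 : ∀ n, 0 ≤ occupationDensity lam t n ((t + η / c) / 2) := fun n =>
    occupationDensity_nonneg hlam (by linarith) (by linarith) n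
  rw [← hS.tsum_eq, ENNReal.ofReal_tsum_of_nonneg
    (fun n => mul_nonneg (by positivity) (add_nonneg (hn1 n) (hn2 n))) hS.summable,
    ENNReal.tsum_prod']
  refine tsum_congr fun n => ?_
  rw [tsum_fintype, Fin.sum_univ_two,
    ENNReal.ofReal_mul (p := 1 / 4 * p ^ (n + 1) * (1 / (2 * c))) (by positivity),
    ENNReal.ofReal_mul (p := 1 / 4 * p ^ (n + 1)) (by positivity), ENNReal.ofReal_add (hn1 n) (hn2 n)]
  simp only [Fin.val_zero, Fin.val_one, add_zero]
  rw [← mul_add, ← mul_add, ← mul_assoc]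
  congr 1
  rcases neg_one_pow_eq_or ℝ (n + 1) with h | h
  · rw [pow_succ _ (n + 1), h]
    simp only [one_mul, neg_one_mul, neg_div, sub_neg_eq_add]
  · rw [pow_succ _ (n + 1), h, add_comm]
    simp only [one_mul, neg_one_mul, neg_neg, neg_div, sub_neg_eq_add]

/-- The law of `X(t) - Y(t)` on the event `X(t) + Y(t) = ct`, away from the endpoints. -/
theorem IsPlanarMotion.measure_boundary {Ω : Type*} [MeasurableSpace Ω] {P : Measure Ω}
    [IsProbabilityMeasure P] {c lam p t : ℝ} {τ : ℕ → Ω → ℝ} {ξ : ℕ → Ω → Fin 4}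
    (h : IsPlanarMotion P lam p τ ξ) (hc : 0 < c) (hlam : 0 < lam) (hp : 0 ≤ p) (ht : 0 < t)
    {B : Set ℝ} (hBm : MeasurableSet B) (hB : B ⊆ Set.Ioo (-(c * t)) (c * t)) :
    P {ω | posX c τ ξ t ω + posY c τ ξ t ω = c * t ∧ posX c τ ξ t ω - posY c τ ξ t ω ∈ B} =
      ∫⁻ η in B, ENNReal.ofReal (boundaryDensity c lam p η t) := by
  have hpre : ∀ q : ℕ × Fin 2, MeasurableSet
      ((fun u : ℝ => c * ((-1) ^ (q.1 + 1 + (q.2 : ℕ)) * (t - 2 * u))) ⁻¹' B) := fun q =>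
    (show Measurable fun u : ℝ => c * ((-1) ^ (q.1 + 1 + (q.2 : ℕ)) * (t - 2 * u)) by
      fun_prop) hBm
  have hmeas : ∀ q : ℕ × Fin 2, Measurable fun η : ℝ => ENNReal.ofReal (1 / (2 * c)) *
      ENNReal.ofReal (occupationDensity lam t q.1
        ((t - (-1) ^ (q.1 + 1 + (q.2 : ℕ)) * η / c) / 2)) := fun q =>
    (ENNReal.measurable_ofReal.comp ((continuous_occupationDensity lam t q.1).measurable.comp
      (by fun_prop))).const_mul _
  refine (measure_congr (Filter.eventuallyEq_set.2 (h.ae_mem_iff hlam hc ht hB))).trans ?_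
  rw [measure_iUnion₀ (h.aedisjoint_alternatingEvent hlam t _)
      fun q => (h.measurableSet_alternatingEvent t _ _ (hpre q)).nullMeasurableSet,
    ← setLIntegral_congr_fun hBm fun η hη => ofReal_boundaryDensity hc hlam.le hp (hB hη),
    lintegral_tsum fun q => ((hmeas q).const_mul _).aemeasurable]
  refine tsum_congr fun q => ?_
  rw [h.measure_alternatingEvent hlam t _ _ (hpre q), setLIntegral_affine_preimage hc _ hBm hB,
    lintegral_const_mul _ (hmeas q)]

/-- On the interval the density is a countable sum of measurable functions of η, which bypasses the
measurability of `deriv` in a parameter. -/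
theorem aestronglyMeasurable_boundaryDensity {c lam p t : ℝ} (hc : 0 < c) (hlam : 0 ≤ lam)
    (hp : 0 ≤ p) (ht : 0 ≤ t) : AEStronglyMeasurable (fun η => boundaryDensity c lam p η t)
      (volume.restrict (Set.Ioo (-(c * t)) (c * t))) := by
  have hm : Measurable fun η : ℝ => (∑' q : ℕ × Fin 2, ENNReal.ofReal (1 / 4 * p ^ (q.1 + 1)) *
      (ENNReal.ofReal (1 / (2 * c)) * ENNReal.ofReal (occupationDensity lam t q.1
        ((t - (-1) ^ (q.1 + 1 + (q.2 : ℕ)) * η / c) / 2)))).toReal := by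
    refine (Measurable.tsum fun q => ?_).ennreal_toReal
    exact (((ENNReal.measurable_ofReal.comp
      ((continuous_occupationDensity lam t q.1).measurable.comp
      (by fun_prop))).const_mul _).const_mul _)
  refine hm.aestronglyMeasurable.congr ?_
  filter_upwards [ae_restrict_mem measurableSet_Ioo] with η hη
  have hpos := sq_sub_sq_pos_of_mem_Ioo hη
  rw [mul_pow] at hpos
  rw [ofReal_boundaryDensity hc hlam hp hη,
    ENNReal.toReal_ofReal (boundaryDensity_nonneg hc hlam hp ht hpos)]

theorem theorem5 {Ω : Type*} [MeasurableSpace Ω] (P : Measure Ω) [IsProbabilityMeasure P]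
    (c lam p : ℝ) (hc : 0 < c) (hlam : 0 < lam) (hp0 : 0 < p) (hp1 : p < 1)
    (τ : ℕ → Ω → ℝ) (ξ : ℕ → Ω → Fin 4) (h : IsPlanarMotion P lam p τ ξ)
    (t : ℝ) (ht : 0 < t) :
    (∀ η ∈ Set.Ioo (-(c * t)) (c * t),
      DifferentiableAt ℝ
        (fun s : ℝ => besselI0 (lam * p / c * √(c ^ 2 * s ^ 2 - η ^ 2))) t ∧
      0 ≤ boundaryDensity c lam p η t) ∧
    IntegrableOn (fun η => boundaryDensity c lam p η t) (Set.Ioo (-(c * t)) (c * t)) ∧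
    ∀ B : Set ℝ, MeasurableSet B → B ⊆ Set.Ioo (-(c * t)) (c * t) →
      P.real {ω | posX c τ ξ t ω + posY c τ ξ t ω = c * t ∧
          posX c τ ξ t ω - posY c τ ξ t ω ∈ B} =
        ∫ η in B, boundaryDensity c lam p η t := by

  have hpos : ∀ η ∈ Set.Ioo (-(c * t)) (c * t), 0 < c ^ 2 * t ^ 2 - η ^ 2 := fun η hη => by
    have := sq_sub_sq_pos_of_mem_Ioo hη
    rwa [mul_pow] at this
  have hnn : ∀ η ∈ Set.Ioo (-(c * t)) (c * t), 0 ≤ boundaryDensity c lam p η t := fun η hη =>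
    boundaryDensity_nonneg hc hlam.le hp0.le ht.le (hpos η hη)
  have hmeas := aestronglyMeasurable_boundaryDensity hc hlam.le hp0.le ht.le
  refine ⟨fun η hη => ⟨(hasDerivAt_besselI0_sqrt (hpos η hη)).differentiableAt, hnn η hη⟩,
    ⟨hmeas, ?_⟩, fun B hBm hB => ?_⟩
  -- The integral over the whole interval is itself a probability, hence finite.
  · rw [hasFiniteIntegral_iff_ofReal ((ae_restrict_mem measurableSet_Ioo).mono hnn),
      ← h.measure_boundary hc hlam hp0.le ht measurableSet_Ioo subset_rfl]
    exact measure_lt_top _ _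
  · rw [integral_eq_lintegral_of_nonneg_ae
      ((ae_restrict_mem hBm).mono fun η hη => hnn η (hB hη))
      (hmeas.mono_measure (Measure.restrict_mono hB le_rfl)),
      ← h.measure_boundary hc hlam hp0.le ht hBm hB]
    rfl
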